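/- Setting. $G$ is a finite acyclic directed multigraph embedded on the oriented sphere, $<$ is an acyclic order of its vertices (a linear order with $u<v$ for every arc $uv$), $H$ is a finite set of demand arcs on $V(G)$ and $r:E(H)\to\mathbb N$ gives their requests. We assume that $H$ is a matching (no loops, and distinct demand arcs share no vertex), that the tail $t$ of each demand arc $ts$ is a sink of $G$ and its head $s$ a source of $G$, and that $G+H$ is Eulerian: at each vertex, the number of arcs of $G$ leaving it plus the requests of the demand arcs leaving it equals the number of arcs of $G$ entering it plus the requests of the demand arcs entering it. A path is a nonempty sequence of distinct arcs of $G$ in which the head of each arc is the tail of the next one; an $(s,t)$-path has origin $s$ and destination $t$. A solution is a set $\mathcal P$ of pairwise arc-disjoint paths such that every path of $\mathcal P$ is an $(s,t)$-path for some demand arc $ts$, and $\mathcal P$ contains exactly $r(ts)$ $(s,t)$-paths for every demand arc $ts$. In a cyclic order, an interval is either empty or the set of all elements met when going from an element $a$ in the positive direction until an element $c$ is first reached, both included; $a$ and $c$ are its extremities. Two distinct arc-disjoint paths $P,Q$ cross at $v$ if $v$ is an inner vertex of both and, in the anticlockwise cyclic order of the arcs around $v$, the two arcs of $P$ at $v$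 do not lie in a common interval whose extremities are the two arcs of $Q$ at $v$; $P$ and $Q$ cross if they cross at some vertex. A solution is uncrossed if (i) two of its paths with a common endpoint never cross, and (ii) two of its paths that cross do so at a unique vertex, namely their first (with respect to $<$) common vertex. The $(s,t)$-paths of $\mathcal P$ are cyclically ordered by their first arcs in the anticlockwise order around $s$. Statement. Let $t_1s_1$ and $t_2s_2$ be two distinct demand arcs and let $\mathcal P$ be an uncrossed solution. Then there are an interval $\mathcal I_1$ of the $(s_1,t_1)$-paths of $\mathcal P$ and an interval $\mathcal I_2$ of the $(s_2,t_2)$-paths of $\mathcal P$ such that, for every $(s_1,t_1)$-path $P\in\mathcal P$ and every $(s_2,t_2)$-path $Q\in\mathcal P$, the paths $P$ and $Q$ cross if and only if either $P\in\mathcal I_1$ and $Q\in\mathcal I_2$, or $P\notin\mathcal I_1$ and $Q\notin\mathcal I_2$. -/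

import Mathlib

/-- A directed multigraph with vertex type `V` and arc type `A` (parallel arcs are allowed). -/
structure Multidigraph (V A : Type*) where
  tail : A → V
  head : A → V

namespace Multidigraph

variable {V A D : Type*}

/-- No arc enters `v`. -/
def IsSource (G : Multidigraph V A) (v : V) : Prop := ∀ a, G.head a ≠ v

/-- No arc leaves `v`. -/
def IsSink (G : Multidigraph V A) (v : V) : Prop := ∀ a, G.tail a ≠ v

/-- The linear order on the vertices is an acyclic (topological) order of `G`:
every arc goes from a smaller vertex to a greater one. -/
def IsAcyclicOrder [LinearOrder V] (G : Multidigraph V A) : Prop :=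
  ∀ a, G.tail a < G.head a

/-- The arcs are not loops and distinct arcs have no vertex in common. -/
def IsMatching (H : Multidigraph V D) : Prop :=
  (∀ h, H.tail h ≠ H.head h) ∧
  ∀ h h', h ≠ h' → H.tail h ≠ H.tail h' ∧ H.tail h ≠ H.head h' ∧
    H.head h ≠ H.tail h' ∧ H.head h ≠ H.head h'

/-- `G + H` is Eulerian, where every arc of `G` has capacity one and an arc `h` of `H` is counted
`r h` times: at each vertex the total out-degree is equal to the total in-degree. -/
def IsEulerian [DecidableEq V] [Fintype A] [Fintype D]
    (G : Multidigraph V A) (H : Multidigraph V D) (r : D → ℕ) : Prop :=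
  ∀ v, (Finset.univ.filter fun a => G.tail a = v).card
        + ∑ h ∈ Finset.univ.filter (fun h => H.tail h = v), r h
      = (Finset.univ.filter fun a => G.head a = v).card
        + ∑ h ∈ Finset.univ.filter (fun h => H.head h = v), r h

/-! ### Directed paths -/

/-- A directed path: a nonempty sequence of distinct arcs in which the head of each arc is the tail
of the following one. -/
@[ext]
structure DiPath (G : Multidigraph V A) where
  arcs : List A
  ne_nil : arcs ≠ []
  nodup : arcs.Nodup
  chain : arcs.IsChain fun a b => G.head a = G.tail b

namespace DiPath

variable {G : Multidigraph V A}

def firstArc (P : G.DiPath) : A := P.arcs.head P.ne_nil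

def lastArc (P : G.DiPath) : A := P.arcs.getLast P.ne_nil

def origin (P : G.DiPath) : V := G.tail P.firstArc

def destination (P : G.DiPath) : V := G.head P.lastArc

/-- The set of vertices incident to the arcs of the path. -/
def vertices (P : G.DiPath) : Set V := {v | ∃ a ∈ P.arcs, G.tail a = v ∨ G.head a = v}

/-- `v` is an inner vertex of `P`, entered through the arc `a` and left through the arc `b`. -/
def PassesThrough (P : G.DiPath) (v : V) (a b : A) : Prop :=
  [a, b] <:+: P.arcs ∧ G.head a = v ∧ G.tail b = v

def ArcDisjoint (P Q : G.DiPath) : Prop := List.Disjoint P.arcs Q.arcs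

def ShareEndpoint (P Q : G.DiPath) : Prop :=
  P.origin = Q.origin ∨ P.origin = Q.destination ∨
    P.destination = Q.origin ∨ P.destination = Q.destination

end DiPath

/-! ### Embeddings on the sphere -/

/-- The darts (half-arcs) of a digraph: `(a, true)` is the half of `a` at its tail, and
`(a, false)` is the half of `a` at its head. -/
abbrev Dart (_G : Multidigraph V A) : Type _ := A × Bool

/-- The vertex at which a dart is attached. -/
def dartVertex (G : Multidigraph V A) (d : G.Dart) : V :=
  if d.2 then G.tail d.1 else G.head d.1

/-- The involution that exchanges the two halves of every arc. -/
def flip (G : Multidigraph V A) : Equiv.Perm G.Dart :=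
  Equiv.prodCongr (Equiv.refl A) Equiv.boolNot

/-- An embedding of a (finite) digraph on the oriented sphere, given as a rotation system of
genus zero. The permutation `rot` sends a dart to the next dart in anticlockwise order around the
same vertex. The orbits of `rot` are the vertices that are not isolated, those of `rot * flip` are
the boundary walks of the faces, and those of the group generated by `rot` and `flip` are the
connected components that have an arc; the last field is Euler's formula
`#vertices - #arcs + #faces = 2`, summed over these components. (As the genus of each component is
nonnegative, this means that every component is embedded on the sphere.) -/
structure SphereEmbedding (G : Multidigraph V A) where
  rot : Equiv.Perm G.Dart
  sameCycle_iff : ∀ d d' : G.Dart, rot.SameCycle d d' ↔ G.dartVertex d = G.dartVertex d'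
  euler :
    Nat.card (Quotient (Equiv.Perm.SameCycle.setoid rot))
      + Nat.card (Quotient (Equiv.Perm.SameCycle.setoid (rot * G.flip)))
    = Nat.card A
      + 2 * Nat.card (MulAction.orbitRel.Quotient
          (Subgroup.closure ({rot, G.flip} : Set (Equiv.Perm G.Dart))) G.Dart)

namespace SphereEmbedding

variable {G : Multidigraph V A} (emb : G.SphereEmbedding)

/-- For darts `x`, `y`, `z` at the same vertex: `y` is between `x` and `z` (both included) in the
anticlockwise order, that is, `y` is met when one turns from `x` until `z` is reached for the first
time. -/
def Between (x y z : G.Dart) : Prop :=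
  ∃ k : ℕ, (emb.rot ^ k) x = y ∧ ∀ l < k, (emb.rot ^ l) x ≠ z

/-- `P` and `Q` cross at `v`: `v` is an inner vertex of both, and the two arcs of `P` at `v` do not
lie in the same interval with extremities the two arcs of `Q` at `v`. -/
def CrossAt (P Q : G.DiPath) (v : V) : Prop :=
  ∃ p p' q q' : A, P.PassesThrough v p p' ∧ Q.PassesThrough v q q' ∧
    ¬ (emb.Between (q, false) (p, false) (q', true) ∧
        emb.Between (q, false) (p', true) (q', true)) ∧
    ¬ (emb.Between (q', true) (p, false) (q, false) ∧
        emb.Between (q', true) (p', true) (q, false))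

/-- `P` and `Q` cross at some vertex. -/
def Cross (P Q : G.DiPath) : Prop := ∃ v, emb.CrossAt P Q v

/-- A set of paths is uncrossed if two paths with a common endpoint do not cross, and two paths that
cross do so at a unique vertex, their first (that is, smallest) common vertex. -/
def Uncrossed [LinearOrder V] (Ps : Finset G.DiPath) : Prop :=
  (∀ P ∈ Ps, ∀ Q ∈ Ps, P ≠ Q → P.ShareEndpoint Q → ¬ emb.Cross P Q) ∧
  (∀ P ∈ Ps, ∀ Q ∈ Ps, P ≠ Q →
    ∀ v, emb.CrossAt P Q v → IsLeast (P.vertices ∩ Q.vertices) v)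

/-- `I` is an interval of a family `S` of arc-disjoint paths with the same origin and destination,
cyclically ordered by their first arcs around their origin: `I` is empty, or it consists of the
members of `S` between two given members of `S`. -/
def IsInterval (S I : Set G.DiPath) : Prop :=
  I = ∅ ∨ ∃ P ∈ S, ∃ R ∈ S,
    I = {Q | Q ∈ S ∧ emb.Between (P.firstArc, true) (Q.firstArc, true) (R.firstArc, true)}

end SphereEmbedding

/-! ### Solutions -/

/-- The paths of `Ps` that serve the demand arc `h = ts`, that is, its `(s,t)`-paths. -/
def demandPaths {G : Multidigraph V A} (H : Multidigraph V D) (Ps : Finset G.DiPath) (h : D) :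
    Set G.DiPath :=
  {P | P ∈ Ps ∧ P.origin = H.head h ∧ P.destination = H.tail h}

/-- `Ps` is a solution of the arc-disjoint paths problem: its paths are pairwise arc-disjoint, each
of them serves some demand arc, and each demand arc `h` is served by exactly `r h` of them. -/
structure IsSolution (G : Multidigraph V A) (H : Multidigraph V D) (r : D → ℕ)
    (Ps : Finset G.DiPath) : Prop where
  arcDisjoint : ∀ P ∈ Ps, ∀ Q ∈ Ps, P ≠ Q → P.ArcDisjoint Q
  serves : ∀ P ∈ Ps, ∃ h, P ∈ demandPaths H Ps h
  request : ∀ h, (demandPaths H Ps h).ncard = r h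

end Multidigraph

/-!
The proof is homology modulo two on the sphere, applied to cycles made of two paths with the same
endpoints.

*Planarity.* By Euler's formula, every cycle modulo two of `G` is the boundary of a set of faces
(`SphereEmbedding.exists_potential`). Its characteristic function, a *potential* of the cycle,
changes exactly across the arcs of the cycle. For two paths `P`, `R` with the same endpoints, the
cycle is their sum, and a potential changes along an arc-disjoint path `Q` exactly where `Q` crosses
one of `P` and `R` but not the other (`IsPotential.apply_of_passesThrough`).

*All the paths of a demand behave alike.* As two paths of different demands cross at most once, the
change of the potential of `P + R` from the origin of `Q` to its destination tells whether exactly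
one of `P`, `R` crosses `Q`. This change depends on the endpoints of `Q` only, since `P` and `R`
avoid them. So whether `P` and `R` agree on crossing `Q` is the same for all the paths `Q` of a
demand (`cross_iff_cross_iff`).

*Intervals.* Suppose that `P₁, P₂, P₃, P₄` are paths of one demand, in this cyclic order around
their origin, and that `Q` crosses `P₁` and `P₃` but neither `P₂` nor `P₄`. A potential of `P₂ + P₄`
is constant along `Q`, `P₁` and `P₃`, none of which crosses the cycle, and it takes the same value
on two of these paths that cross each other (`IsPotential.eq_of_cross`). Hence `P₁` and `P₃` start
on the same side of the cycle, whereas `P₂` and `P₄` separate them around the origin. As there are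
no such four paths, the paths of a demand that cross `Q` form an interval, and so do those that do
not (`IsUncrossedBundle.isInterval_cross`).

Fix a path `P₀` of the first demand and a path `Q₀` of the second one. The intervals sought are the
set of the paths `P` that cross `Q₀`, and the set of the paths `Q` that `P₀` treats like `Q₀`, that
is, crosses if and only if it crosses `Q₀`.
-/

/-! ### Functions that are constant on the classes of an equivalence relation -/

/-- The functions `X → 𝔽₂` that are constant on the classes of `s`. -/
def Setoid.invariantFunctions {X : Type*} (s : Setoid X) : Submodule (ZMod 2) (X → ZMod 2) where
  carrier := {f | ∀ x y, s x y → f x = f y}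
  add_mem' hf hg x y h := by simp [hf x y h, hg x y h]
  zero_mem' _ _ _ := rfl
  smul_mem' c f hf x y h := by simp [hf x y h]

theorem Setoid.finrank_invariantFunctions {X : Type*} [Finite X] (s : Setoid X) :
    Module.finrank (ZMod 2) s.invariantFunctions = Nat.card (Quotient s) := by
  classical
  have := Fintype.ofFinite X
  have := Fintype.ofFinite (Quotient s)
  let e : s.invariantFunctions ≃ₗ[ZMod 2] (Quotient s → ZMod 2) :=
    { toFun := fun f => Quotient.lift f.1 f.2
      invFun := fun g => ⟨fun x => g ⟦x⟧, fun x y h => congrArg g (Quotient.sound h)⟩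
      map_add' := fun f g => by ext q; induction q using Quotient.inductionOn; rfl
      map_smul' := fun c f => by ext q; induction q using Quotient.inductionOn; rfl
      left_inv := fun f => rfl
      right_inv := fun g => by ext q; induction q using Quotient.inductionOn; rfl }
  rw [e.finrank_eq, Module.finrank_fintype_fun_eq_card, Nat.card_eq_fintype_card]

theorem Equiv.Perm.mem_invariantFunctions_sameCycle {X : Type*} {σ : Equiv.Perm X}
    {f : X → ZMod 2} :
    f ∈ (Equiv.Perm.SameCycle.setoid σ).invariantFunctions ↔ ∀ x, f (σ x) = f x := by
  constructor
  · exact fun h x => (h x (σ x) ⟨1, by simp⟩).symm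
  · rintro h x _ ⟨k, rfl⟩
    have hinv : ∀ x, f (σ⁻¹ x) = f x := fun x => by rw [← h (σ⁻¹ x)]; simp
    induction k using Int.induction_on with
    | zero => simp
    | succ k ih => rw [add_comm, zpow_add, zpow_one, Equiv.Perm.mul_apply, h]; exact ih
    | pred k ih =>
      rw [sub_eq_add_neg, add_comm, zpow_add, zpow_neg_one, Equiv.Perm.mul_apply, hinv]; exact ih

theorem Subgroup.mem_invariantFunctions_orbitRel_closure {X : Type*} {σ τ : Equiv.Perm X}
    {f : X → ZMod 2} :
    f ∈ (MulAction.orbitRel (Subgroup.closure ({σ, τ} : Set (Equiv.Perm X))) X).invariantFunctions ↔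
      (∀ x, f (σ x) = f x) ∧ ∀ x, f (τ x) = f x := by
  have hσ : σ ∈ Subgroup.closure ({σ, τ} : Set (Equiv.Perm X)) :=
    Subgroup.subset_closure (by simp)
  have hτ : τ ∈ Subgroup.closure ({σ, τ} : Set (Equiv.Perm X)) :=
    Subgroup.subset_closure (by simp)
  constructor
  · intro h
    exact ⟨fun x => h _ _ ⟨⟨σ, hσ⟩, rfl⟩, fun x => h _ _ ⟨⟨τ, hτ⟩, rfl⟩⟩
  · rintro ⟨h₁, h₂⟩ _ x ⟨⟨g, hg⟩, rfl⟩
    change f (g x) = f x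
    induction hg using Subgroup.closure_induction generalizing x with
    | mem g hg =>
      rcases hg with rfl | rfl
      exacts [h₁ x, h₂ x]
    | one => rfl
    | mul a b _ _ iha ihb => rw [Equiv.Perm.mul_apply, iha, ihb]
    | inv a _ iha => rw [← iha (a⁻¹ x)]; simp

namespace Multidigraph

variable {V A : Type*} {G : Multidigraph V A}

/-! ### Potentials on the faces of a spherical embedding -/

/-- The linear map that adds up, over `𝔽₂`, the values of a function at the two halves of each arc.
On functions of the vertices it is the coboundary map; on functions of the faces it is the boundary
map. -/
def sumHalves (A : Type*) : (A × Bool → ZMod 2) →ₗ[ZMod 2] (A → ZMod 2) where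
  toFun f a := f (a, true) + f (a, false)
  map_add' f g := by ext a; simp; ring
  map_smul' c f := by ext a; simp [mul_add]

/-- The orthogonal complement of `W` for the dot product, with its dimension. -/
theorem exists_orthogonal_dotProduct {A : Type*} [Fintype A] (W : Submodule (ZMod 2) (A → ZMod 2)) :
    ∃ Z : Submodule (ZMod 2) (A → ZMod 2), (∀ χ, χ ∈ Z ↔ ∀ w ∈ W, w ⬝ᵥ χ = 0) ∧
      Module.finrank (ZMod 2) W + Module.finrank (ZMod 2) Z = Fintype.card A := by
  classical
  refine ⟨(W.map (dotProductEquiv (ZMod 2) A).toLinearMap).dualCoannihilator, fun χ => ?_, ?_⟩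
  · rw [Submodule.mem_dualCoannihilator]
    constructor
    · exact fun h w hw => h _ (Submodule.mem_map_of_mem hw)
    · rintro h _ ⟨w, hw, rfl⟩
      exact h w hw
  · have := Subspace.finrank_add_finrank_dualCoannihilator_eq
      (W.map (dotProductEquiv (ZMod 2) A).toLinearMap)
    rw [LinearEquiv.finrank_map_eq, Module.finrank_fintype_fun_eq_card] at this
    exact this

theorem flip_flip (d : G.Dart) : G.flip (G.flip d) = d := by
  obtain ⟨a, b⟩ := d
  simp [flip]

theorem sumHalves_apply_fst (f : A × Bool → ZMod 2) (d : G.Dart) :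
    sumHalves A f d.1 = f d + f (G.flip d) := by
  obtain ⟨a, b⟩ := d
  cases b
  · exact add_comm _ _
  · rfl

theorem sumHalves_eq_zero_iff {f : G.Dart → ZMod 2} :
    sumHalves A f = 0 ↔ ∀ d, f (G.flip d) = f d := by
  constructor
  · intro h d
    have h' : f d + f (G.flip d) = 0 := by rw [← sumHalves_apply_fst, h]; rfl
    exact (CharTwo.add_eq_zero.1 h').symm
  · intro h
    ext a
    change f (a, true) + f (G.flip (a, true)) = 0
    rw [h, CharTwo.add_self_eq_zero]

theorem sumHalves_dotProduct [Fintype A] (h : G.Dart → ZMod 2) (χ : A → ZMod 2) :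
    sumHalves A h ⬝ᵥ χ = ∑ d : G.Dart, h d * χ d.1 := by
  rw [Fintype.sum_prod_type]
  simp [dotProduct, sumHalves, add_mul]

/-- Rank and nullity of `sumHalves` on the functions constant on the classes of `s`, when the kernel
consists of those constant on the classes of `t`. -/
theorem finrank_map_sumHalves [Finite A] {s t : Setoid G.Dart}
    (h : ∀ f, f ∈ t.invariantFunctions ↔ f ∈ s.invariantFunctions ∧ sumHalves A f = 0) :
    Module.finrank (ZMod 2) (s.invariantFunctions.map (sumHalves A)) + Nat.card (Quotient t)
      = Nat.card (Quotient s) := by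
  have hker : t.invariantFunctions = s.invariantFunctions ⊓ LinearMap.ker (sumHalves A) := by
    ext f
    exact h f
  rw [← Setoid.finrank_invariantFunctions, ← Setoid.finrank_invariantFunctions,
    ← LinearMap.finrank_range_add_finrank_ker ((sumHalves A).domRestrict s.invariantFunctions),
    LinearMap.range_domRestrict, LinearMap.ker_domRestrict]
  congr 1
  rw [← Submodule.finrank_map_subtype_eq, Submodule.map_comap_subtype, hker]

namespace SphereEmbedding

variable (emb : G.SphereEmbedding)

/-- Every cycle modulo two on the sphere is the boundary of a set of faces: `f` is the
characteristic function of this set, whose value at a dart is that of the face on the right-hand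
side of the dart. The boundaries of sets of faces are orthogonal to the cuts, and Euler's formula
says that the two spaces have complementary dimensions. -/
theorem exists_potential [Fintype V] [DecidableEq V] [Fintype A] (χ : A → ZMod 2)
    (hχ : ∀ v, ∑ d : G.Dart with G.dartVertex d = v, χ d.1 = 0) :
    ∃ f : G.Dart → ZMod 2, ∀ d, f (emb.rot d) = f d + χ d.1 ∧ f (G.flip d) = f d + χ d.1 := by
  set σ := Equiv.Perm.SameCycle.setoid emb.rot
  set φ := Equiv.Perm.SameCycle.setoid (emb.rot * G.flip)
  set c := MulAction.orbitRel
    (Subgroup.closure ({emb.rot, G.flip} : Set (Equiv.Perm G.Dart))) G.Dart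
  have hσ := finrank_map_sumHalves (s := σ) (t := c) fun f => by
    rw [Subgroup.mem_invariantFunctions_orbitRel_closure,
      Equiv.Perm.mem_invariantFunctions_sameCycle, sumHalves_eq_zero_iff]
  have hface : ∀ f, f ∈ φ.invariantFunctions ↔ ∀ d, f (emb.rot d) = f (G.flip d) := fun f => by
    rw [Equiv.Perm.mem_invariantFunctions_sameCycle]
    constructor
    · intro h d
      rw [← h (G.flip d), Equiv.Perm.mul_apply, flip_flip]
    · intro h d
      rw [Equiv.Perm.mul_apply, h, flip_flip]
  have hφ := finrank_map_sumHalves (s := φ) (t := c) fun f => by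
    rw [Subgroup.mem_invariantFunctions_orbitRel_closure, hface, sumHalves_eq_zero_iff]
    constructor
    · exact fun h => ⟨fun d => (h.1 d).trans (h.2 d).symm, h.2⟩
    · exact fun h => ⟨fun d => (h.1 d).trans (h.2 d), h.2⟩
  obtain ⟨Z, hZ, hZrank⟩ := exists_orthogonal_dotProduct (σ.invariantFunctions.map (sumHalves A))
  have hle : φ.invariantFunctions.map (sumHalves A) ≤ Z := by
    rintro _ ⟨f, hf, rfl⟩
    rw [hZ]
    rintro _ ⟨h, hh, rfl⟩
    replace hf := (hface f).1 hf
    replace hh := Equiv.Perm.mem_invariantFunctions_sameCycle.1 hh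
    rw [sumHalves_dotProduct]
    simp only [sumHalves_apply_fst, mul_add, Finset.sum_add_distrib]
    rw [← Equiv.sum_comp emb.rot fun d => h d * f d]
    simp only [hh, hf, CharTwo.add_self_eq_zero]
  have heq : φ.invariantFunctions.map (sumHalves A) = Z := by
    refine Submodule.eq_of_le_of_finrank_eq hle ?_
    have : Nat.card (Quotient σ) + Nat.card (Quotient φ) = Nat.card A + 2 * Nat.card (Quotient c) :=
      emb.euler
    rw [Nat.card_eq_fintype_card (α := A)] at this
    omega
  have hmem : χ ∈ Z := by
    rw [hZ]
    rintro _ ⟨h, hh, rfl⟩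
    rw [sumHalves_dotProduct, ← Finset.sum_fiberwise _ (fun d => G.dartVertex d)]
    refine Finset.sum_eq_zero fun v _ => ?_
    by_cases hv : ∃ e : G.Dart, G.dartVertex e = v
    · obtain ⟨e, rfl⟩ := hv
      rw [Finset.sum_congr rfl (g := fun d : G.Dart => h e * χ d.1), ← Finset.mul_sum, hχ,
        mul_zero]
      intro d hd
      rw [hh d e ((emb.sameCycle_iff d e).2 (Finset.mem_filter.1 hd).2)]
    · rw [Finset.filter_false_of_mem fun d _ hd => hv ⟨d, hd⟩, Finset.sum_empty]
  rw [← heq] at hmem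
  obtain ⟨f, hf, rfl⟩ := hmem
  refine ⟨f, fun d => ?_⟩
  rw [sumHalves_apply_fst, (hface f).1 hf, ← add_assoc, CharTwo.add_self_eq_zero, zero_add]
  exact ⟨rfl, rfl⟩

/-! ### Positions in the rotation around a vertex -/

/-- The number of anticlockwise steps from the dart `b` to the dart `d` around their common vertex
(and `0` if `b` and `d` are at distinct vertices). It linearizes the cyclic order of the darts
around that vertex, starting at `b`. -/
noncomputable def pos (b d : G.Dart) : ℕ := sInf {k | (emb.rot ^ k) b = d}

variable {emb} {b d e x y z : G.Dart}

theorem dartVertex_rot_pow (k : ℕ) (b : G.Dart) :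
    G.dartVertex ((emb.rot ^ k) b) = G.dartVertex b :=
  ((emb.sameCycle_iff _ _).1 ⟨k, by simp⟩).symm

theorem pos_self : emb.pos b b = 0 :=
  Nat.sInf_eq_zero.2 (Or.inl rfl)

theorem pos_le {k : ℕ} (h : (emb.rot ^ k) b = d) : emb.pos b d ≤ k :=
  Nat.sInf_le h

section Finite

variable [Finite A]

theorem rot_pow_pos (h : G.dartVertex d = G.dartVertex b) : (emb.rot ^ emb.pos b d) b = d :=
  Nat.sInf_mem (s := {k | (emb.rot ^ k) b = d})
    ((emb.sameCycle_iff b d).2 h.symm).exists_nat_pow_eq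

theorem pos_inj (hd : G.dartVertex d = G.dartVertex b) (he : G.dartVertex e = G.dartVertex b) :
    emb.pos b d = emb.pos b e ↔ d = e := by
  refine ⟨fun h => ?_, fun h => h ▸ rfl⟩
  rw [← emb.rot_pow_pos hd, h, emb.rot_pow_pos he]

/-- Within two turns around the vertex of `b`, a dart is met at its position and at one full turn
(`n` steps) from there. -/
theorem exists_period (emb : G.SphereEmbedding) (b : G.Dart) :
    ∃ n, (∀ d, G.dartVertex d = G.dartVertex b → emb.pos b d < n) ∧
      ∀ d, G.dartVertex d = G.dartVertex b → ∀ k < 2 * n,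
        ((emb.rot ^ k) b = d ↔ k = emb.pos b d ∨ k = emb.pos b d + n) := by
  have hper : ∀ k, (emb.rot ^ (k % Function.minimalPeriod emb.rot b)) b = (emb.rot ^ k) b :=
    fun k => by
      rw [← Equiv.Perm.iterate_eq_pow, ← Equiv.Perm.iterate_eq_pow]
      exact Function.iterate_mod_minimalPeriod_eq
  have hpos : 0 < Function.minimalPeriod emb.rot b :=
    Function.minimalPeriod_pos_of_mem_periodicPts
      (Function.Injective.mem_periodicPts emb.rot.injective b)
  have hlt : ∀ d, G.dartVertex d = G.dartVertex b →
      emb.pos b d < Function.minimalPeriod emb.rot b := fun d hd =>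
    (pos_le ((hper _).trans (rot_pow_pos hd))).trans_lt (Nat.mod_lt _ hpos)
  refine ⟨_, hlt, fun d hd k hk => ?_⟩
  have hmod : (emb.rot ^ k) b = d ↔ k % Function.minimalPeriod emb.rot b = emb.pos b d := by
    conv_lhs => rw [← emb.rot_pow_pos hd, ← hper k]
    rw [← Equiv.Perm.iterate_eq_pow, ← Equiv.Perm.iterate_eq_pow]
    exact Function.iterate_eq_iterate_iff_of_lt_minimalPeriod (Nat.mod_lt _ hpos) (hlt d hd)
  rw [hmod]
  have := hlt d hd
  rcases lt_or_ge k (Function.minimalPeriod emb.rot b) with h | h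
  · rw [Nat.mod_eq_of_lt h]
    omega
  · rw [Nat.mod_eq_sub_mod h, Nat.mod_eq_of_lt (by omega)]
    omega

/-- The cyclic interval from `x` to `z` in terms of the linear order of the positions: it wraps
around `b` when `z` comes before `x`. -/
theorem between_iff (hx : G.dartVertex x = G.dartVertex b) (hy : G.dartVertex y = G.dartVertex b)
    (hz : G.dartVertex z = G.dartVertex b) :
    emb.Between x y z ↔
      (emb.pos b x ≤ emb.pos b y ∧ emb.pos b y ≤ emb.pos b z) ∨
      (emb.pos b z < emb.pos b x ∧ (emb.pos b x ≤ emb.pos b y ∨ emb.pos b y ≤ emb.pos b z)) := by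
  obtain ⟨n, hlt, hn⟩ := exists_period emb b
  have hxn := hlt x hx
  have hyn := hlt y hy
  have hzn := hlt z hz
  have hadd : ∀ k, (emb.rot ^ k) x = (emb.rot ^ (k + emb.pos b x)) b := fun k => by
    rw [pow_add, Equiv.Perm.mul_apply, rot_pow_pos hx]
  simp only [Between, hadd]
  constructor
  · rintro ⟨k, hk, hl⟩
    rcases le_or_gt (emb.pos b x) (emb.pos b z) with h | h
    · have hk' : k ≤ emb.pos b z - emb.pos b x := by
        by_contra! hlt
        exact hl _ hlt ((hn z hz _ (by omega)).2 (by omega))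
      rw [hn y hy _ (by omega)] at hk
      omega
    · have hk' : k ≤ n + emb.pos b z - emb.pos b x := by
        by_contra! hlt
        exact hl _ hlt ((hn z hz _ (by omega)).2 (by omega))
      rw [hn y hy _ (by omega)] at hk
      omega
  · intro h
    rcases le_or_gt (emb.pos b x) (emb.pos b y) with hxy | hxy
    · refine ⟨emb.pos b y - emb.pos b x, (hn y hy _ (by omega)).2 (by omega), fun l hl hlz => ?_⟩
      rw [hn z hz _ (by omega)] at hlz
      omega
    · refine ⟨n + emb.pos b y - emb.pos b x, (hn y hy _ (by omega)).2 (by omega),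
        fun l hl hlz => ?_⟩
      rw [hn z hz _ (by omega)] at hlz
      omega

/-- Turning from `b` to `d` meets exactly the darts that come before `d` when the rotation is cut
open at `b`. -/
theorem sum_range_pos [Fintype A] [DecidableEq V] (χ : A → ZMod 2)
    (hd : G.dartVertex d = G.dartVertex b) :
    ∑ l ∈ Finset.range (emb.pos b d), χ ((emb.rot ^ l) b).1 =
      ∑ e : G.Dart with G.dartVertex e = G.dartVertex b,
        if emb.pos b e < emb.pos b d then χ e.1 else 0 := by
  have hpos : ∀ l < emb.pos b d, emb.pos b ((emb.rot ^ l) b) = l := by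
    intro l hl
    obtain ⟨n, hlt, hn⟩ := exists_period emb b
    have h := (hn _ (dartVertex_rot_pow l b) l (by have := hlt d hd; omega)).1 rfl
    have := hlt d hd
    omega
  rw [← Finset.sum_filter, Finset.filter_filter]
  refine Finset.sum_bij (fun l _ => (emb.rot ^ l) b) ?_ ?_ ?_ (fun _ _ => rfl)
  · intro l hl
    rw [Finset.mem_range] at hl
    simpa [dartVertex_rot_pow, hpos l hl] using hl
  · intro l hl m hm h
    rw [Finset.mem_range] at hl hm
    rw [← hpos l hl, h, hpos m hm]
  · intro e he
    obtain ⟨-, he, hlt⟩ := Finset.mem_filter.1 he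
    exact ⟨_, Finset.mem_range.2 hlt, rot_pow_pos he⟩

end Finite

end SphereEmbedding

/-! ### Directed paths in an acyclic digraph -/

namespace DiPath

variable {P Q : G.DiPath} {v : V} {a b p p' : A}

theorem firstArc_mem (P : G.DiPath) : P.firstArc ∈ P.arcs := List.head_mem _

theorem lastArc_mem (P : G.DiPath) : P.lastArc ∈ P.arcs := List.getLast_mem _

theorem head_eq_tail_of_infix (h : [a, b] <:+: P.arcs) : G.head a = G.tail b :=
  (List.isChain_pair (R := fun a b => G.head a = G.tail b)).1 (P.chain.infix h)

theorem PassesThrough.mem_left (h : P.PassesThrough v p p') : p ∈ P.arcs :=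
  h.1.subset (by simp)

theorem PassesThrough.mem_right (h : P.PassesThrough v p p') : p' ∈ P.arcs :=
  h.1.subset (by simp)

theorem exists_passesThrough_of_ne_lastArc (ha : a ∈ P.arcs) (hne : a ≠ P.lastArc) :
    ∃ p', P.PassesThrough (G.head a) a p' := by
  obtain ⟨s, t, hst⟩ := List.append_of_mem ha
  cases t with
  | nil => exact absurd (by simp [lastArc, hst]) hne
  | cons c t =>
    have hinf : [a, c] <:+: P.arcs := ⟨s, t, by simp [hst]⟩
    exact ⟨c, hinf, rfl, (head_eq_tail_of_infix hinf).symm⟩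

theorem exists_passesThrough_of_ne_firstArc (ha : a ∈ P.arcs) (hne : a ≠ P.firstArc) :
    ∃ p, P.PassesThrough (G.tail a) p a := by
  obtain ⟨s, t, hst⟩ := List.append_of_mem ha
  rcases List.eq_nil_or_concat s with rfl | ⟨s, c, rfl⟩
  · exact absurd (by simp [firstArc, hst]) hne
  · have hinf : [c, a] <:+: P.arcs := ⟨s, t, by simp [hst]⟩
    exact ⟨c, hinf, head_eq_tail_of_infix hinf, rfl⟩

theorem head_injOn [LinearOrder V] (hG : G.IsAcyclicOrder) (ha : a ∈ P.arcs) (hb : b ∈ P.arcs)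
    (h : G.head a = G.head b) : a = b := by
  have hlt : P.arcs.Pairwise fun a b => G.head a < G.head b := by
    have : IsTrans A fun a b => G.head a < G.head b := ⟨fun _ _ _ => lt_trans⟩
    rw [← List.isChain_iff_pairwise]
    exact P.chain.imp fun a b (hab : G.head a = G.tail b) => hab.trans_lt (hG b)
  have hnodup : (P.arcs.map G.head).Nodup := List.pairwise_map.2 (hlt.imp fun h => h.ne)
  exact List.inj_on_of_nodup_map hnodup ha hb h

theorem tail_injOn [LinearOrder V] (hG : G.IsAcyclicOrder) (ha : a ∈ P.arcs) (hb : b ∈ P.arcs)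
    (h : G.tail a = G.tail b) : a = b := by
  have hlt : P.arcs.Pairwise fun a b => G.tail a < G.tail b := by
    have : IsTrans A fun a b => G.tail a < G.tail b := ⟨fun _ _ _ => lt_trans⟩
    rw [← List.isChain_iff_pairwise]
    exact P.chain.imp fun a b (hab : G.head a = G.tail b) => (hG a).trans_eq hab
  have hnodup : (P.arcs.map G.tail).Nodup := List.pairwise_map.2 (hlt.imp fun h => h.ne)
  exact List.inj_on_of_nodup_map hnodup ha hb h

/-- The path leads from a source to a sink of the digraph. -/
def SourceToSink (P : G.DiPath) : Prop := G.IsSource P.origin ∧ G.IsSink P.destination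

/-- The characteristic function over `𝔽₂` of the set of arcs of a path. -/
noncomputable def indicator (P : G.DiPath) : A → ZMod 2 :=
  open Classical in fun a => if a ∈ P.arcs then 1 else 0

theorem indicator_of_mem (h : a ∈ P.arcs) : P.indicator a = 1 := if_pos h

theorem indicator_of_notMem (h : a ∉ P.arcs) : P.indicator a = 0 := if_neg h

theorem indicator_of_disjoint (h : P.ArcDisjoint Q) (ha : a ∈ Q.arcs) : P.indicator a = 0 :=
  indicator_of_notMem fun h' => h h' ha

theorem ArcDisjoint.symm (h : P.ArcDisjoint Q) : Q.ArcDisjoint P := List.Disjoint.symm h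

/-- The boundary modulo two of a path consists of its two endpoints. -/
theorem sum_indicator_dartVertex [Fintype A] [DecidableEq V] (P : G.DiPath) (v : V) :
    ∑ d : G.Dart with G.dartVertex d = v, P.indicator d.1 =
      (if P.origin = v then 1 else 0) + (if P.destination = v then 1 else 0) := by
  classical
  set δ : V → ZMod 2 := fun u => if u = v then 1 else 0
  have htel : ∀ (l : List A) (hl : l ≠ []), (l.IsChain fun a b => G.head a = G.tail b) →
      (l.map fun a => δ (G.tail a) + δ (G.head a)).sum =
        δ (G.tail (l.head hl)) + δ (G.head (l.getLast hl)) := by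
    intro l
    induction l with
    | nil => exact fun hl => absurd rfl hl
    | cons a l ih =>
      intro _ hc
      cases l with
      | nil => simp
      | cons c l =>
        rw [List.isChain_cons_cons] at hc
        rw [List.map_cons, List.sum_cons, ih (by simp) hc.2, hc.1]
        simp only [List.head_cons, List.getLast_cons_cons]
        rw [add_assoc, ← add_assoc (δ (G.tail c)), CharTwo.add_self_eq_zero, zero_add]
  have hsum : ∑ d : G.Dart with G.dartVertex d = v, P.indicator d.1 =
      ∑ a ∈ P.arcs.toFinset, (δ (G.tail a) + δ (G.head a)) := by
    rw [Finset.sum_filter, Fintype.sum_prod_type]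
    simp only [Fintype.sum_bool, dartVertex, indicator]
    rw [← Finset.sum_filter_add_sum_filter_not Finset.univ (· ∈ P.arcs)]
    rw [Finset.sum_eq_zero (s := Finset.univ.filter fun a => ¬ a ∈ P.arcs), add_zero]
    · refine Finset.sum_congr (by ext; simp) fun a ha => ?_
      rw [List.mem_toFinset] at ha
      simp [ha, δ]
    · intro a ha
      simp [(Finset.mem_filter.1 ha).2]
  rw [hsum, List.sum_toFinset _ P.nodup]
  exact htel P.arcs P.ne_nil P.chain

end DiPath

/-! ### Counting the darts of a path in a turn around a vertex -/

namespace DiPath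

variable {P Q : G.DiPath} {v : V} {p p' : A}

theorem PassesThrough.dart_eq [LinearOrder V] (hG : G.IsAcyclicOrder)
    (h : P.PassesThrough v p p') {e : G.Dart} (he : G.dartVertex e = v) (hmem : e.1 ∈ P.arcs) :
    e = (p, false) ∨ e = (p', true) := by
  obtain ⟨a, _ | _⟩ := e
  · exact Or.inl (Prod.ext (head_injOn hG hmem h.mem_left (he.trans h.2.1.symm)) rfl)
  · exact Or.inr (Prod.ext (tail_injOn hG hmem h.mem_right (he.trans h.2.2.symm)) rfl)

theorem PassesThrough.dartVertex_left (h : P.PassesThrough v p p') :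
    G.dartVertex (p, false) = v := h.2.1

theorem PassesThrough.dartVertex_right (h : P.PassesThrough v p p') :
    G.dartVertex (p', true) = v := h.2.2

/-- At a vertex that is neither a source nor a sink, a path from a source to a sink has no dart,
or it passes through this vertex. -/
theorem SourceToSink.forall_notMem_or_passesThrough (hP : P.SourceToSink)
    (hsrc : ¬ G.IsSource v) (hsink : ¬ G.IsSink v) :
    (∀ e : G.Dart, G.dartVertex e = v → e.1 ∉ P.arcs) ∨ ∃ p p', P.PassesThrough v p p' := by
  by_contra! hcon
  obtain ⟨⟨⟨a, _ | _⟩, rfl, ha⟩, h⟩ := hcon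
  · obtain ⟨p', hp'⟩ := exists_passesThrough_of_ne_lastArc ha
      (by rintro rfl; exact hsink hP.2)
    exact h _ _ hp'
  · obtain ⟨p, hp⟩ := exists_passesThrough_of_ne_firstArc ha
      (by rintro rfl; exact hsrc hP.1)
    exact h _ _ hp

theorem PassesThrough.not_isSource (h : P.PassesThrough v p p') : ¬ G.IsSource v :=
  fun hv => hv p h.2.1

theorem PassesThrough.not_isSink (h : P.PassesThrough v p p') : ¬ G.IsSink v :=
  fun hv => hv p' h.2.2

theorem eq_firstArc_of_isSource {a : A} (hP : G.IsSource (G.tail a)) (ha : a ∈ P.arcs) :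
    a = P.firstArc := by
  by_contra hne
  obtain ⟨p, hp⟩ := exists_passesThrough_of_ne_firstArc ha hne
  exact hp.not_isSource hP

theorem notMem_of_dartVertex_isSource (hv : G.IsSource v)
    (hne : P.origin ≠ v) (d : G.Dart) (hd : G.dartVertex d = v) : d.1 ∉ P.arcs := by
  obtain ⟨a, _ | _⟩ := d
  · exact fun _ => hv a hd
  · intro ha
    have hd' : G.tail a = v := hd
    have := eq_firstArc_of_isSource (hd' ▸ hv) ha
    exact hne (by rw [origin, ← this, hd'])

theorem notMem_of_dartVertex_isSink (hv : G.IsSink v)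
    (hne : P.destination ≠ v) (d : G.Dart) (hd : G.dartVertex d = v) : d.1 ∉ P.arcs := by
  obtain ⟨a, _ | _⟩ := d
  · intro ha
    have hd' : G.head a = v := hd
    by_cases h : a = P.lastArc
    · exact hne (by rw [destination, ← h, hd'])
    · obtain ⟨p', hp'⟩ := exists_passesThrough_of_ne_lastArc ha h
      exact hp'.not_isSink (hd' ▸ hv)
  · exact fun _ => hv a hd

end DiPath

namespace SphereEmbedding

variable (emb : G.SphereEmbedding)

/-- The parity of the number of darts of `P` that are met when turning anticlockwise from the dart
`b`, included, to the dart `d`, excluded. -/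
noncomputable def turn (P : G.DiPath) (b d : G.Dart) : ZMod 2 :=
  ∑ l ∈ Finset.range (emb.pos b d), P.indicator ((emb.rot ^ l) b).1

variable {emb} {P Q R : G.DiPath} {v : V} {p p' q q' x x' : A} {b d : G.Dart}

theorem turn_eq_zero
    (h : ∀ e : G.Dart, G.dartVertex e = G.dartVertex b → e.1 ∉ P.arcs) :
    emb.turn P b d = 0 :=
  Finset.sum_eq_zero fun l _ => DiPath.indicator_of_notMem (h _ (dartVertex_rot_pow l b))

theorem turn_of_forall_eq [Finite A] [LinearOrder V] {e : G.Dart}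
    (hd : G.dartVertex d = G.dartVertex b) (he : G.dartVertex e = G.dartVertex b)
    (hmem : e.1 ∈ P.arcs)
    (h : ∀ e' : G.Dart, G.dartVertex e' = G.dartVertex b → e'.1 ∈ P.arcs → e' = e) :
    emb.turn P b d = if emb.pos b e < emb.pos b d then 1 else 0 := by
  have := Fintype.ofFinite A
  rw [turn, sum_range_pos _ hd, Finset.sum_eq_single e, DiPath.indicator_of_mem hmem]
  · intro e' he' hne
    rw [DiPath.indicator_of_notMem fun hm => hne (h e' (Finset.mem_filter.1 he').2 hm), ite_self]
  · exact fun hcon => absurd (by simpa using he) hcon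

theorem turn_of_passesThrough [Finite A] [LinearOrder V] (hG : G.IsAcyclicOrder)
    (hP : P.PassesThrough v p p') (hb : G.dartVertex b = v) (hd : G.dartVertex d = v) :
    emb.turn P b d = (if emb.pos b (p, false) < emb.pos b d then 1 else 0) +
      (if emb.pos b (p', true) < emb.pos b d then 1 else 0) := by
  classical
  have := Fintype.ofFinite A
  subst hb
  rw [turn, sum_range_pos _ hd,
    ← Finset.sum_subset (s₁ := {((p, false) : G.Dart), ((p', true) : G.Dart)}),
    Finset.sum_pair (by simp), DiPath.indicator_of_mem hP.mem_left,
    DiPath.indicator_of_mem hP.mem_right]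
  · intro e he
    rcases Finset.mem_insert.1 he with rfl | he
    · simpa using hP.dartVertex_left
    · rw [Finset.mem_singleton] at he
      subst he
      simpa using hP.dartVertex_right
  · intro e he hne
    rw [DiPath.indicator_of_notMem, ite_self]
    intro hm
    rcases hP.dart_eq hG (Finset.mem_filter.1 he).2 hm with rfl | rfl <;> simp at hne

theorem pos_ne_pos [Finite A] (hdisj : P.ArcDisjoint Q) {a c : A} {i j : Bool} (ha : a ∈ P.arcs)
    (hc : c ∈ Q.arcs) (hav : G.dartVertex (a, i) = G.dartVertex b)
    (hcv : G.dartVertex (c, j) = G.dartVertex b) : emb.pos b (a, i) ≠ emb.pos b (c, j) := by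
  intro h
  rw [pos_inj hav hcv] at h
  cases h
  exact hdisj ha hc

/-- Two arc-disjoint paths through `v` cross there if and only if, once the rotation around `v` is
cut open at some dart, exactly one of the darts of `P` lies between the two darts of `Q`. -/
theorem crossAt_iff [Finite A] [LinearOrder V] (hG : G.IsAcyclicOrder) (hdisj : P.ArcDisjoint Q)
    (hP : P.PassesThrough v p p') (hQ : Q.PassesThrough v q q') (hb : G.dartVertex b = v) :
    emb.CrossAt P Q v ↔
      Xor (Xor (emb.pos b (p, false) < emb.pos b (q, false))
          (emb.pos b (p', true) < emb.pos b (q, false)))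
        (Xor (emb.pos b (p, false) < emb.pos b (q', true))
          (emb.pos b (p', true) < emb.pos b (q', true))) := by
  subst hb
  have hp := hP.dartVertex_left
  have hp' := hP.dartVertex_right
  have hq := hQ.dartVertex_left
  have hq' := hQ.dartVertex_right
  have h₁ := pos_ne_pos (emb := emb) hdisj hP.mem_left hQ.mem_left hp hq
  have h₂ := pos_ne_pos (emb := emb) hdisj hP.mem_left hQ.mem_right hp hq'
  have h₃ := pos_ne_pos (emb := emb) hdisj hP.mem_right hQ.mem_left hp' hq
  have h₄ := pos_ne_pos (emb := emb) hdisj hP.mem_right hQ.mem_right hp' hq'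
  have hcross : emb.CrossAt P Q (G.dartVertex b) ↔
      ¬ (emb.Between (q, false) (p, false) (q', true) ∧
        emb.Between (q, false) (p', true) (q', true)) ∧
      ¬ (emb.Between (q', true) (p, false) (q, false) ∧
        emb.Between (q', true) (p', true) (q, false)) := by
    constructor
    · rintro ⟨p₁, p₁', q₁, q₁', hP₁, hQ₁, h⟩
      obtain rfl := DiPath.head_injOn hG hP₁.mem_left hP.mem_left (hP₁.2.1.trans hP.2.1.symm)
      obtain rfl := DiPath.tail_injOn hG hP₁.mem_right hP.mem_right (hP₁.2.2.trans hP.2.2.symm)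
      obtain rfl := DiPath.head_injOn hG hQ₁.mem_left hQ.mem_left (hQ₁.2.1.trans hQ.2.1.symm)
      obtain rfl := DiPath.tail_injOn hG hQ₁.mem_right hQ.mem_right (hQ₁.2.2.trans hQ.2.2.symm)
      exact h
    · exact fun h => ⟨p, p', q, q', hP, hQ, h⟩
  have h₅ : emb.pos b (q, false) ≠ emb.pos b (q', true) := fun h => by
    rw [pos_inj hq hq'] at h
    cases h
  rw [hcross, between_iff hq hp hq', between_iff hq hp' hq', between_iff hq' hp hq,
    between_iff hq' hp' hq]
  simp only [Xor]
  generalize emb.pos b (p, false) = a₁ at *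
  generalize emb.pos b (p', true) = a₂ at *
  generalize emb.pos b (q, false) = a₃ at *
  generalize emb.pos b (q', true) = a₄ at *
  omega

theorem crossAt_comm [Finite A] [LinearOrder V] (hG : G.IsAcyclicOrder) (hdisj : P.ArcDisjoint Q) :
    emb.CrossAt P Q v ↔ emb.CrossAt Q P v := by
  suffices h : ∀ {P Q : G.DiPath}, P.ArcDisjoint Q → emb.CrossAt P Q v → emb.CrossAt Q P v from
    ⟨h hdisj, h hdisj.symm⟩
  intro P Q hdisj h
  obtain ⟨p, p', q, q', hP, hQ, -⟩ := id h
  have hb := hP.dartVertex_left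
  rw [crossAt_iff hG hdisj hP hQ hb] at h
  rw [crossAt_iff hG hdisj.symm hQ hP hb]
  have hp := hP.dartVertex_left.trans hb.symm
  have hp' := hP.dartVertex_right.trans hb.symm
  have hq := hQ.dartVertex_left.trans hb.symm
  have hq' := hQ.dartVertex_right.trans hb.symm
  have h₁ := pos_ne_pos (emb := emb) hdisj hP.mem_left hQ.mem_left hp hq
  have h₂ := pos_ne_pos (emb := emb) hdisj hP.mem_left hQ.mem_right hp hq'
  have h₃ := pos_ne_pos (emb := emb) hdisj hP.mem_right hQ.mem_left hp' hq
  have h₄ := pos_ne_pos (emb := emb) hdisj hP.mem_right hQ.mem_right hp' hq'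
  simp only [Xor] at h ⊢
  omega

theorem cross_comm [Finite A] [LinearOrder V] (hG : G.IsAcyclicOrder) (hdisj : P.ArcDisjoint Q) :
    emb.Cross P Q ↔ emb.Cross Q P :=
  exists_congr fun _ => crossAt_comm hG hdisj

open Classical in
/-- The parity of the number of darts of `P` between the two darts of `Q` tells whether `P` crosses
`Q` at `v`. -/
theorem turn_add_turn [Finite A] [LinearOrder V] (hG : G.IsAcyclicOrder) (hP : P.SourceToSink)
    (hdisj : P.ArcDisjoint Q) (hQ : Q.PassesThrough v q q') (hb : G.dartVertex b = v) :
    emb.turn P b (q, false) + emb.turn P b (q', true) = if emb.CrossAt P Q v then 1 else 0 := by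
  rcases hP.forall_notMem_or_passesThrough hQ.not_isSource hQ.not_isSink with h | ⟨p, p', hPv⟩
  · subst hb
    rw [turn_eq_zero h, turn_eq_zero h, if_neg, add_zero]
    rintro ⟨p, p', _, _, hPv, -⟩
    exact h _ hPv.dartVertex_left hPv.mem_left
  · rw [turn_of_passesThrough hG hPv hb hQ.dartVertex_left,
      turn_of_passesThrough hG hPv hb hQ.dartVertex_right]
    simp only [crossAt_iff hG hdisj hPv hQ hb, Xor]
    split_ifs <;> first | (exfalso; omega) | rfl

/-- A path that crosses neither of two crossing paths at their common vertex `v` has both of its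
darts at `v` in the same one of the four sectors that these paths form around `v`. -/
theorem turn_eq_turn_of_crossAt [Finite A] [LinearOrder V] (hG : G.IsAcyclicOrder)
    (hR : R.SourceToSink) (hRP : R.ArcDisjoint P) (hRQ : R.ArcDisjoint Q) (hPQ : P.ArcDisjoint Q)
    (hP : P.PassesThrough v p p') (hQ : Q.PassesThrough v q q') (hb : G.dartVertex b = v)
    (hcross : emb.CrossAt P Q v) (hP' : ¬ emb.CrossAt R P v) (hQ' : ¬ emb.CrossAt R Q v) :
    emb.turn R b (p, false) = emb.turn R b (q, false) := by
  rcases hR.forall_notMem_or_passesThrough hP.not_isSource hP.not_isSink with h | ⟨x, x', hRv⟩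
  · subst hb
    rw [turn_eq_zero h, turn_eq_zero h]
  · rw [crossAt_iff hG hPQ hP hQ hb] at hcross
    rw [crossAt_iff hG hRP hRv hP hb] at hP'
    rw [crossAt_iff hG hRQ hRv hQ hb] at hQ'
    subst hb
    have h₁ := pos_ne_pos (emb := emb) hPQ hP.mem_left hQ.mem_left
      hP.dartVertex_left hQ.dartVertex_left
    have h₂ := pos_ne_pos (emb := emb) hPQ hP.mem_left hQ.mem_right
      hP.dartVertex_left hQ.dartVertex_right
    have h₃ := pos_ne_pos (emb := emb) hPQ hP.mem_right hQ.mem_left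
      hP.dartVertex_right hQ.dartVertex_left
    have h₄ := pos_ne_pos (emb := emb) hPQ hP.mem_right hQ.mem_right
      hP.dartVertex_right hQ.dartVertex_right
    rw [turn_of_passesThrough hG hRv rfl hP.dartVertex_left,
      turn_of_passesThrough hG hRv rfl hQ.dartVertex_left]
    simp only [Xor] at *
    split_ifs <;> first | (exfalso; omega) | rfl

end SphereEmbedding

/-! ### Potentials along a path -/

theorem _root_.List.getLast_eq_head_add_sum {M : Type*} [AddCommMonoid M] {F c : A → M}
    {l : List A} (hl : l ≠ []) (h : ∀ a b, [a, b] <:+: l → F b = F a + c a) :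
    F (l.getLast hl) = F (l.head hl) + (l.dropLast.map c).sum := by
  induction l with
  | nil => exact absurd rfl hl
  | cons a l ih =>
    cases l with
    | nil => simp
    | cons b l =>
      rw [List.getLast_cons_cons, ih (by simp) fun x y hxy => h x y (hxy.trans
        (List.suffix_cons a _).isInfix)]
      simp only [List.head_cons, List.dropLast_cons_cons, List.map_cons, List.sum_cons]
      rw [h a b ⟨[], l, rfl⟩, add_assoc]

theorem _root_.List.eq_head_of_infix {M : Type*} {F : A → M}
    {l : List A} (hl : l ≠ []) (h : ∀ a b, [a, b] <:+: l → F b = F a) :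
    ∀ a ∈ l, F a = F (l.head hl) := by
  induction l with
  | nil => exact absurd rfl hl
  | cons a l ih =>
    intro c hc
    rcases List.mem_cons.1 hc with rfl | hc
    · rfl
    · cases l with
      | nil => simp at hc
      | cons b l =>
        rw [ih (by simp) (fun x y hxy => h x y (hxy.trans (List.suffix_cons a _).isInfix)) c hc]
        exact h a b ⟨[], l, rfl⟩

namespace SphereEmbedding

/-- `f` is a potential of the cycle `P + R` modulo two: a function on the faces that changes exactly
across the arcs of `P` and those of `R`. The value at a dart is that of the face on its right-hand
side. -/
def IsPotential (emb : G.SphereEmbedding) (P R : G.DiPath) (f : G.Dart → ZMod 2) : Prop :=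
  ∀ d, f (emb.rot d) = f d + (P.indicator d.1 + R.indicator d.1) ∧
    f (G.flip d) = f d + (P.indicator d.1 + R.indicator d.1)

variable {emb : G.SphereEmbedding} {P Q Q' R X Y : G.DiPath} {v : V} {q q' x x' : A} {b d : G.Dart}
  {f : G.Dart → ZMod 2}

theorem exists_isPotential [Fintype V] [LinearOrder V] [Fintype A] (emb : G.SphereEmbedding)
    (ho : P.origin = R.origin) (hd : P.destination = R.destination) :
    ∃ f, emb.IsPotential P R f := by
  refine emb.exists_potential (fun a => P.indicator a + R.indicator a) fun v => ?_
  rw [Finset.sum_add_distrib, DiPath.sum_indicator_dartVertex, DiPath.sum_indicator_dartVertex,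
    ho, hd, CharTwo.add_self_eq_zero]

theorem IsPotential.eq_add_turn [Finite A] (hf : emb.IsPotential P R f)
    (hd : G.dartVertex d = G.dartVertex b) : f d = f b + (emb.turn P b d + emb.turn R b d) := by
  have hk : ∀ k, f ((emb.rot ^ k) b) = f b + ∑ l ∈ Finset.range k,
      (P.indicator ((emb.rot ^ l) b).1 + R.indicator ((emb.rot ^ l) b).1) := fun k => by
    induction k with
    | zero => simp
    | succ k ih =>
      rw [pow_succ', Equiv.Perm.mul_apply, (hf _).1, ih, Finset.sum_range_succ, add_assoc]
  rw [turn, turn, ← Finset.sum_add_distrib, ← hk, rot_pow_pos hd]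

theorem IsPotential.eq_of_disjoint (hf : emb.IsPotential P R f) (hP : P.ArcDisjoint Q)
    (hR : R.ArcDisjoint Q) (hq : q ∈ Q.arcs) : f (q, false) = f (q, true) := by
  have h := (hf (q, true)).2
  rw [DiPath.indicator_of_disjoint hP hq, DiPath.indicator_of_disjoint hR hq, add_zero,
    add_zero] at h
  exact h

open Classical in
/-- Along a path `Q`, a potential changes when `Q` crosses exactly one of the two paths of the
cycle. -/
theorem IsPotential.apply_of_passesThrough [Finite A] [LinearOrder V] (hf : emb.IsPotential P R f)
    (hG : G.IsAcyclicOrder) (hPs : P.SourceToSink) (hRs : R.SourceToSink)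
    (hP : P.ArcDisjoint Q) (hR : R.ArcDisjoint Q) (hQ : Q.PassesThrough v q q') :
    f (q', true) = f (q, true) +
      ((if emb.CrossAt P Q v then 1 else 0) + (if emb.CrossAt R Q v then 1 else 0)) := by
  have hq := hQ.dartVertex_left
  rw [← hf.eq_of_disjoint hP hR hQ.mem_left,
    hf.eq_add_turn (hQ.dartVertex_right.trans hq.symm), ← turn_add_turn hG hPs hP hQ hq,
    ← turn_add_turn hG hRs hR hQ hq]
  simp [turn, pos_self]

/-- A potential is constant along a path that does not cross the cycle. -/
theorem IsPotential.eq_firstArc [Finite A] [LinearOrder V] (hf : emb.IsPotential P R f)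
    (hG : G.IsAcyclicOrder) (hPs : P.SourceToSink) (hRs : R.SourceToSink)
    (hP : P.ArcDisjoint Q) (hR : R.ArcDisjoint Q) (hPQ : ¬ emb.Cross P Q) (hRQ : ¬ emb.Cross R Q)
    (hq : q ∈ Q.arcs) : f (q, true) = f (Q.firstArc, true) := by
  refine List.eq_head_of_infix (F := fun a => f (a, true)) Q.ne_nil (fun a c hac => ?_) q hq
  have h := hf.apply_of_passesThrough hG hPs hRs hP hR
    ⟨hac, rfl, (DiPath.head_eq_tail_of_infix hac).symm⟩
  rwa [if_neg fun h => hPQ ⟨_, h⟩, if_neg fun h => hRQ ⟨_, h⟩, add_zero, add_zero] at h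

open Classical in
/-- If `P` and `Q` cross at most once, then counting modulo two the vertices of `Q` where they cross
tells whether they cross. The last arc of `Q` is left out, as its head is not an inner vertex. -/
theorem sum_crossAt [LinearOrder V] (hG : G.IsAcyclicOrder)
    (hunique : ∀ v w, emb.CrossAt P Q v → emb.CrossAt P Q w → v = w) :
    (Q.arcs.dropLast.map fun a => if emb.CrossAt P Q (G.head a) then (1 : ZMod 2) else 0).sum =
      if emb.Cross P Q then 1 else 0 := by
  have hnd : Q.arcs.dropLast.Nodup := Q.nodup.sublist (List.dropLast_sublist _)
  rw [← List.sum_toFinset _ hnd]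
  split_ifs with h
  · obtain ⟨v, hv⟩ := h
    obtain ⟨p, p', q, q', hP, hQ, -⟩ := id hv
    have hmem : q ∈ Q.arcs.dropLast := by
      obtain ⟨s, t, hst⟩ := hQ.1
      rw [← hst, List.append_assoc, List.dropLast_append_of_ne_nil (by simp)]
      simp
    obtain rfl := hQ.2.1
    rw [Finset.sum_eq_single q, if_pos hv]
    · intro a ha hne
      refine if_neg fun hcon => hne ?_
      exact DiPath.head_injOn hG (List.dropLast_subset _ (List.mem_toFinset.1 ha)) hQ.mem_left
        (hunique _ _ hcon hv)
    · exact fun hcon => absurd (List.mem_toFinset.2 hmem) hcon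
  · exact Finset.sum_eq_zero fun a _ => if_neg fun ha => h ⟨_, ha⟩

open Classical in
/-- Between the ends of `Q`, a potential of `P + R` changes by the number of those of `P` and `R`
that cross `Q`. -/
theorem IsPotential.lastArc [Finite A] [LinearOrder V] (hf : emb.IsPotential P R f)
    (hG : G.IsAcyclicOrder) (hPs : P.SourceToSink) (hRs : R.SourceToSink)
    (hP : P.ArcDisjoint Q) (hR : R.ArcDisjoint Q)
    (huP : ∀ v w, emb.CrossAt P Q v → emb.CrossAt P Q w → v = w)
    (huR : ∀ v w, emb.CrossAt R Q v → emb.CrossAt R Q w → v = w) :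
    f (Q.lastArc, false) = f (Q.firstArc, true) +
      ((if emb.Cross P Q then 1 else 0) + (if emb.Cross R Q then 1 else 0)) := by
  rw [hf.eq_of_disjoint hP hR Q.lastArc_mem, ← sum_crossAt hG huP, ← sum_crossAt hG huR,
    ← List.sum_map_add]
  exact List.getLast_eq_head_add_sum (F := fun a => f (a, true)) Q.ne_nil fun a c hac =>
    hf.apply_of_passesThrough hG hPs hRs hP hR
      ⟨hac, rfl, (DiPath.head_eq_tail_of_infix hac).symm⟩

theorem IsPotential.eq_of_forall_notMem [Finite A] (hf : emb.IsPotential P R f)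
    (hd : G.dartVertex d = G.dartVertex b)
    (hP : ∀ e : G.Dart, G.dartVertex e = G.dartVertex b → e.1 ∉ P.arcs)
    (hR : ∀ e : G.Dart, G.dartVertex e = G.dartVertex b → e.1 ∉ R.arcs) : f d = f b := by
  rw [hf.eq_add_turn hd, turn_eq_zero hP, turn_eq_zero hR, add_zero, add_zero]

/-- Two paths `P`, `R` with the same endpoints form a cycle, which separates the endpoints of `Q` if
and only if exactly one of `P` and `R` crosses `Q`. Hence all the paths `Q` with given endpoints
behave alike. -/
theorem cross_iff_cross_iff [Fintype V] [LinearOrder V] [Fintype A] (hG : G.IsAcyclicOrder)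
    (hPs : P.SourceToSink) (hQs : Q.SourceToSink)
    (hoPR : P.origin = R.origin) (hdPR : P.destination = R.destination)
    (hoQ : Q.origin = Q'.origin) (hdQ : Q.destination = Q'.destination)
    (ho : P.origin ≠ Q.origin) (hd : P.destination ≠ Q.destination)
    (hPQ : P.ArcDisjoint Q) (hRQ : R.ArcDisjoint Q) (hPQ' : P.ArcDisjoint Q')
    (hRQ' : R.ArcDisjoint Q')
    (huPQ : ∀ v w, emb.CrossAt P Q v → emb.CrossAt P Q w → v = w)
    (huRQ : ∀ v w, emb.CrossAt R Q v → emb.CrossAt R Q w → v = w)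
    (huPQ' : ∀ v w, emb.CrossAt P Q' v → emb.CrossAt P Q' w → v = w)
    (huRQ' : ∀ v w, emb.CrossAt R Q' v → emb.CrossAt R Q' w → v = w) :
    (emb.Cross P Q ↔ emb.Cross R Q) ↔ (emb.Cross P Q' ↔ emb.Cross R Q') := by
  classical
  obtain ⟨f, hf⟩ := exists_isPotential emb hoPR hdPR
  have hRs : R.SourceToSink := ⟨hoPR ▸ hPs.1, hdPR ▸ hPs.2⟩
  have h₁ := hf.lastArc hG hPs hRs hPQ hRQ huPQ huRQ
  have h₂ := hf.lastArc hG hPs hRs hPQ' hRQ' huPQ' huRQ'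
  have hfirst : f (Q'.firstArc, true) = f (Q.firstArc, true) :=
    hf.eq_of_forall_notMem hoQ.symm (DiPath.notMem_of_dartVertex_isSource hQs.1 ho)
      (DiPath.notMem_of_dartVertex_isSource hQs.1 (hoPR ▸ ho))
  have hlast : f (Q'.lastArc, false) = f (Q.lastArc, false) :=
    hf.eq_of_forall_notMem hdQ.symm (DiPath.notMem_of_dartVertex_isSink hQs.2 hd)
      (DiPath.notMem_of_dartVertex_isSink hQs.2 (hdPR ▸ hd))
  rw [hlast, hfirst, h₁] at h₂
  have h₃ := add_left_cancel h₂
  by_cases c₁ : emb.Cross P Q <;> by_cases c₂ : emb.Cross R Q <;>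
    by_cases c₃ : emb.Cross P Q' <;> by_cases c₄ : emb.Cross R Q' <;>
    simp [c₁, c₂, c₃, c₄] at h₃ ⊢

/-! ### The paths crossed by a given path form an interval -/

/-- Two crossing paths that both avoid crossing the cycle lie on the same side of it. At a vertex
where they cross, the paths of the cycle may touch them, but then have both darts in one sector. -/
theorem IsPotential.eq_of_cross [Finite A] [LinearOrder V] (hf : emb.IsPotential P R f)
    (hG : G.IsAcyclicOrder) (hPs : P.SourceToSink) (hRs : R.SourceToSink)
    (hPQ : P.ArcDisjoint Q) (hRQ : R.ArcDisjoint Q) (hPX : P.ArcDisjoint X) (hRX : R.ArcDisjoint X)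
    (hXQ : X.ArcDisjoint Q) (hcPQ : ¬ emb.Cross P Q) (hcRQ : ¬ emb.Cross R Q)
    (hcPX : ¬ emb.Cross P X) (hcRX : ¬ emb.Cross R X) (hcross : emb.Cross X Q) :
    f (X.firstArc, true) = f (Q.firstArc, true) := by
  obtain ⟨v, hv⟩ := hcross
  obtain ⟨x, x', q, q', hXv, hQv, -⟩ := id hv
  rw [← hf.eq_firstArc hG hPs hRs hPX hRX hcPX hcRX hXv.mem_left,
    ← hf.eq_firstArc hG hPs hRs hPQ hRQ hcPQ hcRQ hQv.mem_left,
    ← hf.eq_of_disjoint hPX hRX hXv.mem_left, ← hf.eq_of_disjoint hPQ hRQ hQv.mem_left,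
    hf.eq_add_turn (hXv.dartVertex_left.trans hQv.dartVertex_left.symm),
    turn_eq_turn_of_crossAt hG hPs hPX hPQ hXQ hXv hQv hQv.dartVertex_left hv
      (fun h => hcPX ⟨v, h⟩) (fun h => hcPQ ⟨v, h⟩),
    turn_eq_turn_of_crossAt hG hRs hRX hRQ hXQ hXv hQv hQv.dartVertex_left hv
      (fun h => hcRX ⟨v, h⟩) (fun h => hcRQ ⟨v, h⟩)]
  simp [turn, pos_self]

/-- At its origin, a path has a single dart, that of its first arc. -/
theorem turn_firstArc [Finite A] [LinearOrder V] (hP : P.SourceToSink)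
    (hb : G.dartVertex b = P.origin) (hd : G.dartVertex d = P.origin) :
    emb.turn P b d = if emb.pos b (P.firstArc, true) < emb.pos b d then 1 else 0 := by
  refine turn_of_forall_eq (hd.trans hb.symm) hb.symm P.firstArc_mem fun e he hmem => ?_
  obtain ⟨a, _ | _⟩ := e
  · exact absurd (he.trans hb) (hP.1 a)
  · have ha : G.tail a = P.origin := he.trans hb
    exact Prod.ext (DiPath.eq_firstArc_of_isSource (ha ▸ hP.1) hmem) rfl

/-- A family of arc-disjoint paths from a given source to a given sink, no two of which cross. -/
structure IsUncrossedBundle (emb : G.SphereEmbedding) (S : Set G.DiPath) (s t : V) : Prop where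
  origin_eq : ∀ P ∈ S, P.origin = s
  destination_eq : ∀ P ∈ S, P.destination = t
  isSource : G.IsSource s
  isSink : G.IsSink t
  arcDisjoint : ∀ P ∈ S, ∀ R ∈ S, P ≠ R → P.ArcDisjoint R
  not_cross : ∀ P ∈ S, ∀ R ∈ S, P ≠ R → ¬ emb.Cross P R

variable {S : Set G.DiPath} {s t : V} {P₁ P₂ P₃ P₄ : G.DiPath}

theorem IsUncrossedBundle.sourceToSink (hS : emb.IsUncrossedBundle S s t) (hP : P ∈ S) :
    P.SourceToSink := by
  rw [DiPath.SourceToSink, hS.origin_eq P hP, hS.destination_eq P hP]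
  exact ⟨hS.isSource, hS.isSink⟩

theorem IsUncrossedBundle.dartVertex (hS : emb.IsUncrossedBundle S s t) (hP : P ∈ S) :
    G.dartVertex (P.firstArc, true) = s := hS.origin_eq P hP

/-- If a path `Q` that does not cross the cycle `P + R` crosses both `X` and `Y`, then these lie on
the same side of this cycle, so that `P` and `R` do not separate them around `s`. -/
theorem IsUncrossedBundle.not_separated [Fintype V] [LinearOrder V] [Fintype A]
    (hS : emb.IsUncrossedBundle S s t) (hG : G.IsAcyclicOrder)
    (hQ : ∀ P ∈ S, P.ArcDisjoint Q) (hP : P ∈ S) (hR : R ∈ S) (hX : X ∈ S) (hY : Y ∈ S)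
    (hcP : ¬ emb.Cross P Q) (hcR : ¬ emb.Cross R Q) (hcX : emb.Cross X Q) (hcY : emb.Cross Y Q)
    (hb : G.dartVertex b = s) :
    (if emb.pos b (P.firstArc, true) < emb.pos b (X.firstArc, true) then (1 : ZMod 2) else 0) +
        (if emb.pos b (R.firstArc, true) < emb.pos b (X.firstArc, true) then 1 else 0) =
      (if emb.pos b (P.firstArc, true) < emb.pos b (Y.firstArc, true) then 1 else 0) +
        (if emb.pos b (R.firstArc, true) < emb.pos b (Y.firstArc, true) then 1 else 0) := by
  obtain ⟨f, hf⟩ := exists_isPotential (P := P) (R := R) emb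
    ((hS.origin_eq P hP).trans (hS.origin_eq R hR).symm)
    ((hS.destination_eq P hP).trans (hS.destination_eq R hR).symm)
  have hPs := hS.sourceToSink hP
  have hRs := hS.sourceToSink hR
  have key : ∀ X ∈ S, emb.Cross X Q → f (X.firstArc, true) = f (Q.firstArc, true) := by
    intro X hX hcX
    have hPX : P ≠ X := by rintro rfl; exact hcP hcX
    have hRX : R ≠ X := by rintro rfl; exact hcR hcX
    exact hf.eq_of_cross hG hPs hRs (hQ P hP) (hQ R hR) (hS.arcDisjoint P hP X hX hPX)
      (hS.arcDisjoint R hR X hX hRX) (hQ X hX) hcP hcR (hS.not_cross P hP X hX hPX)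
      (hS.not_cross R hR X hX hRX) hcX
  have hPb := hb.trans (hS.origin_eq P hP).symm
  have hRb := hb.trans (hS.origin_eq R hR).symm
  have hturn : ∀ X ∈ S, f (X.firstArc, true) = f b +
      ((if emb.pos b (P.firstArc, true) < emb.pos b (X.firstArc, true) then 1 else 0) +
        (if emb.pos b (R.firstArc, true) < emb.pos b (X.firstArc, true) then 1 else 0)) := by
    intro X hX
    have hXv := hS.dartVertex hX
    rw [hf.eq_add_turn (hXv.trans hb.symm),
      turn_firstArc hPs hPb (hXv.trans (hS.origin_eq P hP).symm),
      turn_firstArc hRs hRb (hXv.trans (hS.origin_eq R hR).symm)]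
  have h := (key X hX hcX).trans (key Y hY hcY).symm
  rw [hturn X hX, hturn Y hY] at h
  exact add_left_cancel h

/-- A set of paths of a bundle is an interval as soon as no four paths of the bundle are, in this
cyclic order, inside, outside, inside and outside of it. -/
theorem IsUncrossedBundle.isInterval [Finite A] (hS : emb.IsUncrossedBundle S s t)
    (hfin : S.Finite) {I : Set G.DiPath} (hI : I ⊆ S)
    (halt : ∀ P₁ ∈ I, ∀ P₂ ∈ S \ I, ∀ P₃ ∈ I, ∀ P₄ ∈ S \ I,
      emb.pos (P₄.firstArc, true) (P₁.firstArc, true) <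
          emb.pos (P₄.firstArc, true) (P₂.firstArc, true) →
      emb.pos (P₄.firstArc, true) (P₂.firstArc, true) <
          emb.pos (P₄.firstArc, true) (P₃.firstArc, true) → False) :
    emb.IsInterval S I := by
  rcases I.eq_empty_or_nonempty with rfl | hne
  · exact Or.inl rfl
  -- The rotation around `s` is cut open at a path outside `I`, if there is one.
  obtain ⟨B, hB, hBout⟩ : ∃ B ∈ S, (∃ R ∈ S, R ∉ I) → B ∉ I := by
    by_cases h : ∃ R ∈ S, R ∉ I
    · obtain ⟨R, hR, hRI⟩ := h
      exact ⟨R, hR, fun _ => hRI⟩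
    · obtain ⟨P, hP⟩ := hne
      exact ⟨P, hI hP, fun h' => absurd h' h⟩
  have hvertex : ∀ P ∈ S, G.dartVertex (P.firstArc, true) = G.dartVertex (B.firstArc, true) :=
    fun P hP => (hS.dartVertex hP).trans (hS.dartVertex hB).symm
  set g : G.DiPath → ℕ := fun P => emb.pos (B.firstArc, true) (P.firstArc, true) with hg
  have hinj : ∀ P ∈ S, ∀ R ∈ S, g P = g R → P = R := by
    intro P hP R hR h
    by_contra hPR
    rw [hg] at h
    simp only [pos_inj (hvertex P hP) (hvertex R hR)] at h
    refine hS.arcDisjoint P hP R hR hPR P.firstArc_mem ?_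
    have hfst : P.firstArc = R.firstArc := congrArg Prod.fst h
    exact hfst ▸ R.firstArc_mem
  obtain ⟨P, hP, hmin⟩ := Set.exists_min_image I g (hfin.subset hI) hne
  obtain ⟨R, hR, hmax⟩ := Set.exists_max_image I g (hfin.subset hI) hne
  refine Or.inr ⟨P, hI hP, R, hI hR, Set.ext fun Q => ⟨fun hQ => ⟨hI hQ, ?_⟩, ?_⟩⟩
  · rw [between_iff (hvertex P (hI hP)) (hvertex Q (hI hQ)) (hvertex R (hI hR))]
    exact Or.inl ⟨hmin Q hQ, hmax Q hQ⟩
  · rintro ⟨hQ, hbet⟩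
    rw [between_iff (hvertex P (hI hP)) (hvertex Q hQ) (hvertex R (hI hR))] at hbet
    have hPQR : g P ≤ g Q ∧ g Q ≤ g R :=
      hbet.resolve_right fun h => absurd (hmin R hR) (not_le.2 h.1)
    by_contra hQI
    have hPQ : g P ≠ g Q := fun h => hQI (hinj P (hI hP) Q hQ h ▸ hP)
    have hQR : g Q ≠ g R := fun h => hQI (hinj Q hQ R (hI hR) h ▸ hR)
    exact halt P hP Q ⟨hQ, hQI⟩ R hR B ⟨hB, hBout ⟨Q, hQ, hQI⟩⟩
      (lt_of_le_of_ne hPQR.1 hPQ) (lt_of_le_of_ne hPQR.2 hQR)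

theorem IsUncrossedBundle.pos_pos (hS : emb.IsUncrossedBundle S s t) [Finite A] (hP : P ∈ S)
    (hR : R ∈ S) (hne : P ≠ R) : 0 < emb.pos (P.firstArc, true) (R.firstArc, true) := by
  have h := pos_ne_pos (emb := emb) (b := (P.firstArc, true)) (i := true) (j := true)
    (hS.arcDisjoint P hP R hR hne) P.firstArc_mem
    R.firstArc_mem rfl ((hS.dartVertex hR).trans (hS.dartVertex hP).symm)
  rw [pos_self] at h
  omega

/-- The paths of an uncrossed bundle that are crossed by `Q` form an interval, and so do those that
are not. -/
theorem IsUncrossedBundle.isInterval_cross [Fintype V] [LinearOrder V] [Fintype A]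
    (hS : emb.IsUncrossedBundle S s t) (hfin : S.Finite) (hG : G.IsAcyclicOrder)
    (hQ : ∀ P ∈ S, P.ArcDisjoint Q) :
    emb.IsInterval S {P | P ∈ S ∧ emb.Cross P Q} ∧
      emb.IsInterval S {P | P ∈ S ∧ ¬ emb.Cross P Q} := by
  constructor
  · refine hS.isInterval hfin (fun _ h => h.1) ?_
    rintro P₁ ⟨h₁, c₁⟩ P₂ ⟨h₂, c₂⟩ P₃ ⟨h₃, c₃⟩ P₄ ⟨h₄, c₄⟩ h₁₂ h₂₃
    replace c₂ : ¬ emb.Cross P₂ Q := fun h => c₂ ⟨h₂, h⟩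
    replace c₄ : ¬ emb.Cross P₄ Q := fun h => c₄ ⟨h₄, h⟩
    have h := hS.not_separated hG hQ h₂ h₄ h₁ h₃ c₂ c₄ c₁ c₃ (hS.dartVertex h₄)
    have h₀ := hS.pos_pos h₄ h₁ (by rintro rfl; exact c₄ c₁)
    rw [pos_self, if_neg (by omega), if_pos (by omega), if_pos (by omega), if_pos (by omega)] at h
    exact absurd h (by decide)
  · refine hS.isInterval hfin (fun _ h => h.1) ?_
    rintro P₁ ⟨h₁, c₁⟩ P₂ ⟨h₂, c₂⟩ P₃ ⟨h₃, c₃⟩ P₄ ⟨h₄, c₄⟩ h₁₂ h₂₃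
    replace c₂ : emb.Cross P₂ Q := by_contra fun h => c₂ ⟨h₂, h⟩
    replace c₄ : emb.Cross P₄ Q := by_contra fun h => c₄ ⟨h₄, h⟩
    have h := hS.not_separated hG hQ h₁ h₃ h₂ h₄ c₁ c₃ c₂ c₄ (hS.dartVertex h₄)
    rw [pos_self, if_pos (by omega), if_neg (by omega), if_neg (by omega), if_neg (by omega)] at h
    exact absurd h (by decide)

end SphereEmbedding

end Multidigraph

open Multidigraph in
theorem Multidigraph.SphereEmbedding.Uncrossed.isUncrossedBundle {V A D : Type*} [LinearOrder V]
    {G : Multidigraph V A} {H : Multidigraph V D} {r : D → ℕ} {emb : G.SphereEmbedding}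
    {Ps : Finset G.DiPath} (huncrossed : emb.Uncrossed Ps) (hsol : IsSolution G H r Ps)
    (hterminals : ∀ h, G.IsSink (H.tail h) ∧ G.IsSource (H.head h)) (h : D) :
    emb.IsUncrossedBundle (demandPaths H Ps h) (H.head h) (H.tail h) where
  origin_eq _ hP := hP.2.1
  destination_eq _ hP := hP.2.2
  isSource := (hterminals h).2
  isSink := (hterminals h).1
  arcDisjoint P hP R hR := hsol.arcDisjoint P hP.1 R hR.1
  not_cross P hP R hR hne :=
    huncrossed.1 P hP.1 R hR.1 hne (Or.inl (hP.2.1.trans hR.2.1.symm))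

theorem mainTheorem5 {V A D : Type*} [Fintype V] [LinearOrder V] [Fintype A] [Fintype D]
    (G : Multidigraph V A) (H : Multidigraph V D) (r : D → ℕ)
    (emb : G.SphereEmbedding) (hacyclic : G.IsAcyclicOrder)
    (heuler : Multidigraph.IsEulerian G H r)
    (hmatching : H.IsMatching)
    (hterminals : ∀ h, G.IsSink (H.tail h) ∧ G.IsSource (H.head h))
    (Ps : Finset G.DiPath) (hsol : Multidigraph.IsSolution G H r Ps)
    (huncrossed : emb.Uncrossed Ps)
    (h₁ h₂ : D) (hne : h₁ ≠ h₂) :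
    ∃ I₁ I₂ : Set G.DiPath,
      emb.IsInterval (Multidigraph.demandPaths H Ps h₁) I₁ ∧
      emb.IsInterval (Multidigraph.demandPaths H Ps h₂) I₂ ∧
      ∀ P ∈ Multidigraph.demandPaths H Ps h₁, ∀ Q ∈ Multidigraph.demandPaths H Ps h₂,
        (emb.Cross P Q ↔ (P ∈ I₁ ∧ Q ∈ I₂) ∨ (P ∉ I₁ ∧ Q ∉ I₂)) := by
  have hS₁ := huncrossed.isUncrossedBundle hsol hterminals h₁
  have hS₂ := huncrossed.isUncrossedBundle hsol hterminals h₂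
  have hfin : ∀ h, (Multidigraph.demandPaths H Ps h).Finite := fun h =>
    Ps.finite_toSet.subset fun P hP => hP.1
  obtain ⟨htail, -, -, hhead⟩ := hmatching.2 h₁ h₂ hne
  rcases (Multidigraph.demandPaths H Ps h₁).eq_empty_or_nonempty with he | ⟨P₀, hP₀⟩
  · exact ⟨∅, ∅, Or.inl rfl, Or.inl rfl, fun P hP => absurd hP (by simp [he])⟩
  rcases (Multidigraph.demandPaths H Ps h₂).eq_empty_or_nonempty with he | ⟨Q₀, hQ₀⟩
  · exact ⟨∅, ∅, Or.inl rfl, Or.inl rfl, fun P _ Q hQ => absurd hQ (by simp [he])⟩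
  have hPQ : ∀ P ∈ Multidigraph.demandPaths H Ps h₁, ∀ Q ∈ Multidigraph.demandPaths H Ps h₂,
      P ≠ Q := by
    rintro P hP Q hQ rfl
    exact hhead (hP.2.1.symm.trans hQ.2.1)
  have hdisj : ∀ P ∈ Multidigraph.demandPaths H Ps h₁, ∀ Q ∈ Multidigraph.demandPaths H Ps h₂,
      P.ArcDisjoint Q := fun P hP Q hQ => hsol.arcDisjoint P hP.1 Q hQ.1 (hPQ P hP Q hQ)
  have hunique : ∀ P ∈ Multidigraph.demandPaths H Ps h₁,
      ∀ Q ∈ Multidigraph.demandPaths H Ps h₂, ∀ v w,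
        emb.CrossAt P Q v → emb.CrossAt P Q w → v = w := fun P hP Q hQ v w hv hw =>
    (huncrossed.2 P hP.1 Q hQ.1 (hPQ P hP Q hQ) v hv).unique
      (huncrossed.2 P hP.1 Q hQ.1 (hPQ P hP Q hQ) w hw)
  -- The paths `P` that cross `Q` are those that cross `Q₀`, or all the others; which of the two
  -- occurs can be read off from `P₀`.
  have hrect : ∀ P ∈ Multidigraph.demandPaths H Ps h₁, ∀ Q ∈ Multidigraph.demandPaths H Ps h₂,
      ((emb.Cross P Q ↔ emb.Cross P₀ Q) ↔ (emb.Cross P Q₀ ↔ emb.Cross P₀ Q₀)) := by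
    intro P hP Q hQ
    refine Multidigraph.SphereEmbedding.cross_iff_cross_iff hacyclic
      (hS₁.sourceToSink hP) (hS₂.sourceToSink hQ) (hP.2.1.trans hP₀.2.1.symm)
      (hP.2.2.trans hP₀.2.2.symm) (hQ.2.1.trans hQ₀.2.1.symm) (hQ.2.2.trans hQ₀.2.2.symm)
      ?_ ?_ (hdisj P hP Q hQ) (hdisj P₀ hP₀ Q hQ) (hdisj P hP Q₀ hQ₀) (hdisj P₀ hP₀ Q₀ hQ₀)
      (hunique P hP Q hQ) (hunique P₀ hP₀ Q hQ) (hunique P hP Q₀ hQ₀) (hunique P₀ hP₀ Q₀ hQ₀)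
    · rwa [hP.2.1, hQ.2.1]
    · rwa [hP.2.2, hQ.2.2]
  have hI₁ := (hS₁.isInterval_cross (hfin h₁) hacyclic fun P hP => hdisj P hP Q₀ hQ₀).1
  have hI₂ := hS₂.isInterval_cross (hfin h₂) hacyclic fun Q hQ => (hdisj P₀ hP₀ Q hQ).symm
  have hcomm : ∀ Q ∈ Multidigraph.demandPaths H Ps h₂, emb.Cross Q P₀ ↔ emb.Cross P₀ Q :=
    fun Q hQ => (Multidigraph.SphereEmbedding.cross_comm hacyclic (hdisj P₀ hP₀ Q hQ)).symm
  by_cases h₀ : emb.Cross P₀ Q₀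
  · refine ⟨_, _, hI₁, hI₂.1, fun P hP Q hQ => ?_⟩
    have := hrect P hP Q hQ
    have := hcomm Q hQ
    simp only [Set.mem_ofPred_eq]
    tauto
  · refine ⟨_, _, hI₁, hI₂.2, fun P hP Q hQ => ?_⟩
    have := hrect P hP Q hQ
    have := hcomm Q hQ
    simp only [Set.mem_ofPred_eq]
    tauto
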